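/- A Wigner ensemble is a family of real symmetric random matrices $\tilde X_N=(\tilde X_N(i,j))_{1\le i,j\le N}$, $N\ge 1$, on one probability space $(\Omega,\mathcal F,\mathbb P)$ such that for each $N$ the entries $\tilde X_N(i,j)$, $1\le i\le j\le N$, are independent, all entries (for all $N,i,j$) have the same distribution, $\mathbb E(\tilde X_N(i,j))=0$ and $\mathbb E(\tilde X_N(i,j)^2)=1$. Let $b_N$ be non-negative integers with $b_N\to\infty$ and with $\beta_N:=2b_N+1\le N$ for all $N\ge1$. Given a Wigner ensemble $\tilde X_N$, the banded Wigner ensemble with band width $\beta_N$ is defined by $X_N(i,j)=\tilde X_N(i,j)$ if $|i-j|\le b_N$ and $X_N(i,j)=0$ otherwise; the periodic band matrix ensemble with band width $\beta_N$ is defined by $X_N(i,j)=\tilde X_N(i,j)$ if $\min\{|i-j|,N-|i-j|\}\le b_N$ and $X_N(i,j)=0$ otherwise. **Theorem.** Let $X_N$ be a banded Wigner ensemble or a periodic band matrix ensemble with band width $\beta_N$, and assume that all moments of the entries exist, i.e. $\mathbb E(|X_N(i,j)|^k)<\infty$ for all $k\in\mathbb N$. If there are constants $C>0$ and $\gamma>0$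 such that $\beta_N\ge C\,N^{\gamma}$ for all $N\ge1$, then $$\limsup_{N\to\infty}\Big\|\frac{1}{\sqrt{\beta_N}}\,X_N\Big\|\le 2\qquad \mathbb P\text{-almost surely},$$ where $\|\cdot\|$ is the operator norm on Euclidean space $\mathbb R^N$, i.e. the largest absolute value of an eigenvalue. -/

import Mathlib

open MeasureTheory ProbabilityTheory Filter

namespace BandMatrix

/-- A real symmetric matrix ensemble: for every `N` a random symmetric `N × N` matrix `X N`, whose
entries are real random variables on `Ω`. -/
structure IsMatrixEnsemble {Ω : Type*} [MeasurableSpace Ω]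
    (X : ∀ N : ℕ, Ω → Matrix (Fin N) (Fin N) ℝ) : Prop where
  measurable : ∀ (N : ℕ) (i j : Fin N), Measurable (fun ω => X N ω i j)
  symm : ∀ (N : ℕ) (i j : Fin N) (ω : Ω), X N ω i j = X N ω j i

/-- A Wigner ensemble: a symmetric matrix ensemble such that, for each `N`, the entries on and above
the diagonal are independent, all entries (for all `N`) have the same distribution, and the entries
have mean `0` and second moment `1`. No relation is imposed between the matrices for different
values of `N`, beyond the common distribution of their entries. -/
structure IsWignerEnsemble {Ω : Type*} [MeasurableSpace Ω] (P : Measure Ω)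
    (X : ∀ N : ℕ, Ω → Matrix (Fin N) (Fin N) ℝ) : Prop extends IsMatrixEnsemble X where
  indep : ∀ N : ℕ,
    iIndepFun (fun (p : {p : Fin N × Fin N // p.1 ≤ p.2}) (ω : Ω) => X N ω p.1.1 p.1.2) P
  identDistrib : ∀ (N M : ℕ) (i j : Fin N) (k l : Fin M),
    IdentDistrib (fun ω => X N ω i j) (fun ω => X M ω k l) P P
  mean_zero : ∀ (N : ℕ) (i j : Fin N), ∫ ω, X N ω i j ∂P = 0
  second_moment : ∀ (N : ℕ) (i j : Fin N), ∫ ω, (X N ω i j) ^ 2 ∂P = 1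

/-- All moments of all entries exist. -/
def AllMomentsExist {Ω : Type*} [MeasurableSpace Ω] (P : Measure Ω)
    (X : ∀ N : ℕ, Ω → Matrix (Fin N) (Fin N) ℝ) : Prop :=
  ∀ (N : ℕ) (i j : Fin N) (k : ℕ), Integrable (fun ω => |X N ω i j| ^ k) P

/-- The band width `β_N = 2 b_N + 1`. -/
def bandWidth (b : ℕ → ℕ) (N : ℕ) : ℕ := 2 * b N + 1

/-- The standing assumptions on the half-widths `b_N`: they tend to infinity, and the band width
is at most `N` for every `N ≥ 1`. -/
def IsHalfWidth (b : ℕ → ℕ) : Prop :=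
  Tendsto b atTop atTop ∧ ∀ N : ℕ, 1 ≤ N → bandWidth b N ≤ N

/-- The modulus `min (|k|, N - |k|)` for `|k| ≤ N`; for `k = i - j` with indices `i, j` this is the
distance of `i` and `j` in `ℤ / N ℤ`. -/
def cyclicAbs (N : ℕ) (k : ℤ) : ℤ :=
  min (abs k) (abs ((N : ℤ) - abs k))

/-- A banded Wigner ensemble: the entries of a Wigner ensemble with `|i - j| ≤ b_N` are kept, the
others are replaced by zero. -/
def IsBandedWigner {Ω : Type*} [MeasurableSpace Ω] (P : Measure Ω) (b : ℕ → ℕ)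
    (X : ∀ N : ℕ, Ω → Matrix (Fin N) (Fin N) ℝ) : Prop :=
  IsHalfWidth b ∧ ∃ Y : ∀ N : ℕ, Ω → Matrix (Fin N) (Fin N) ℝ, IsWignerEnsemble P Y ∧
    ∀ (N : ℕ) (ω : Ω) (i j : Fin N),
      X N ω i j = if |((i : ℕ) : ℤ) - ((j : ℕ) : ℤ)| ≤ (b N : ℤ) then Y N ω i j else 0

/-- A periodic band matrix ensemble: the entries of a Wigner ensemble at cyclic distance at most
`b_N` from the diagonal are kept, the others are replaced by zero. -/
def IsPeriodicBandedWigner {Ω : Type*} [MeasurableSpace Ω] (P : Measure Ω) (b : ℕ → ℕ)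
    (X : ∀ N : ℕ, Ω → Matrix (Fin N) (Fin N) ℝ) : Prop :=
  IsHalfWidth b ∧ ∃ Y : ∀ N : ℕ, Ω → Matrix (Fin N) (Fin N) ℝ, IsWignerEnsemble P Y ∧
    ∀ (N : ℕ) (ω : Ω) (i j : Fin N),
      X N ω i j =
        if cyclicAbs N (((i : ℕ) : ℤ) - ((j : ℕ) : ℤ)) ≤ (b N : ℤ) then Y N ω i j else 0

/-- The norm of a matrix as an operator on the Euclidean space `ℝ^N`. -/
noncomputable def opNorm {N : ℕ} (M : Matrix (Fin N) (Fin N) ℝ) : ℝ :=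
  ‖Matrix.toEuclideanCLM (n := Fin N) (𝕜 := ℝ) M‖

end BandMatrix

/-!
The proof is the moment method. The entries are truncated at `N ^ δ` for a small `δ > 0` and
recentred; then `‖X_N‖ ^ (2 p) ≤ tr (X_N ^ (2 p))`, with `2 p` of order `N ^ δ`. The expected trace
is a sum over closed walks, and by independence and centering only the walks without an edge
traversed exactly once contribute.

Instead of enumerating these walks by their shape, one reads a walk step by step and bounds the
contribution of its past by the weight `K ^ surplus * L ^ potential / q ^ #open`, where `q = √β_N`
and an edge is open if it has been traversed exactly once. A step to a new vertex has at most
`q ^ 2` choices and divides the weight by `q`. A step that closes an open edge multiplies the weight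
by `q`; if it can choose between several open edges, the potential drops and pays for the choice.
The other steps are of lower order, so each step contributes a factor `(2 + o(1)) q`. As `p` grows
like a power of `N`, the factor `N` for the starting vertex is harmless, and Markov's inequality and
the Borel-Cantelli lemma conclude.
-/

namespace BandMatrix

open scoped Finset

section Walks

variable {V : Type*} [Fintype V] [DecidableEq V]

/-- The degree of the vertex `v` in the graph with edge set `S`; a loop counts once. -/
def degree (S : Finset (Sym2 V)) (v : V) : ℕ := #{w | s(v, w) ∈ S}

lemma degree_insert {S : Finset (Sym2 V)} {e : Sym2 V} (he : e ∉ S) (v : V) :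
    degree (insert e S) v = degree S v + if v ∈ e then 1 else 0 := by
  split_ifs with hv
  · obtain ⟨w, rfl⟩ := hv
    have hfilter : Finset.univ.filter (fun z => s(v, z) ∈ insert s(v, w) S) =
        insert w (Finset.univ.filter fun z => s(v, z) ∈ S) := by
      ext z
      simp only [Finset.mem_insert, Finset.mem_filter, Finset.mem_univ, true_and, Sym2.congr_right]
    rw [degree, hfilter, Finset.card_insert_of_notMem (by simpa using he), degree]
  · have hne : ∀ z, s(v, z) ≠ e := fun z h => hv (h ▸ Sym2.mem_mk_left v z)
    simp [degree, hne]

lemma degree_erase_add {S : Finset (Sym2 V)} {e : Sym2 V} (he : e ∈ S) (v : V) :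
    degree (S.erase e) v + (if v ∈ e then 1 else 0) = degree S v := by
  rw [← degree_insert (Finset.notMem_erase e S), Finset.insert_erase he]

/-- The total excess of the degrees of `S` over those of a path ending at `u`. Along a walk with
set `S` of once-traversed edges and current vertex `u`, it bounds the number of later steps that
close an edge of `S` while having a choice between several such edges. -/
def potential (S : Finset (Sym2 V)) (u : V) : ℕ := ∑ v, (degree S v - if v = u then 1 else 2)

lemma potential_le_add_one (S : Finset (Sym2 V)) (u w : V) :
    potential S w ≤ potential S u + 1 := by
  calc potential S w
      ≤ ∑ v, ((degree S v - if v = u then 1 else 2) + if v = w then 1 else 0) :=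
        Finset.sum_le_sum fun v _ => by split_ifs <;> omega
    _ = potential S u + 1 := by simp [Finset.sum_add_distrib, potential]

lemma potential_insert_le {S : Finset (Sym2 V)} {u w : V} (he : s(u, w) ∉ S) :
    potential (insert s(u, w) S) w ≤ potential S u + 2 := by
  calc potential (insert s(u, w) S) w
      ≤ ∑ v, ((degree S v - if v = u then 1 else 2) + if v = w then 2 else 0) :=
        Finset.sum_le_sum fun v _ => by
          simp only [degree_insert he, Sym2.mem_iff]
          grind
    _ = potential S u + 2 := by simp [Finset.sum_add_distrib, potential]

lemma potential_insert_le_of_degree_eq_zero {S : Finset (Sym2 V)} {u w : V}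
    (he : s(u, w) ∉ S) (hw : degree S w = 0) :
    potential (insert s(u, w) S) w ≤ potential S u :=
  Finset.sum_le_sum fun v _ => by
    simp only [degree_insert he, Sym2.mem_iff]
    grind

lemma potential_erase_add_le {S : Finset (Sym2 V)} {u w : V} (he : s(u, w) ∈ S) :
    potential (S.erase s(u, w)) w + (if 2 ≤ degree S u then 1 else 0) ≤ potential S u := by
  calc potential (S.erase s(u, w)) w + (if 2 ≤ degree S u then 1 else 0)
      = ∑ v, ((degree (S.erase s(u, w)) v - if v = w then 1 else 2) +
          if v = u then (if 2 ≤ degree S u then 1 else 0) else 0) := by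
        simp [Finset.sum_add_distrib, potential]
    _ ≤ potential S u := Finset.sum_le_sum fun v _ => by
        have hdeg := degree_erase_add he v
        simp only [Sym2.mem_iff] at hdeg
        grind

/-- The edges traversed exactly once by a walk, whose past is recorded as the multiset `m` of its
traversed edges. -/
def openEdges (m : Multiset (Sym2 V)) : Finset (Sym2 V) := {e | m.count e = 1}

lemma mem_openEdges {m : Multiset (Sym2 V)} {e : Sym2 V} : e ∈ openEdges m ↔ m.count e = 1 := by
  simp [openEdges]

lemma openEdges_cons_of_notMem {m : Multiset (Sym2 V)} {e : Sym2 V} (he : e ∉ m) :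
    openEdges (e ::ₘ m) = insert e (openEdges m) := by
  ext f
  have := Multiset.count_eq_zero_of_notMem he
  by_cases hf : f = e <;> simp [mem_openEdges, hf, this]

lemma openEdges_cons_of_mem {m : Multiset (Sym2 V)} {e : Sym2 V} (he : e ∈ m) :
    openEdges (e ::ₘ m) = (openEdges m).erase e := by
  ext f
  have := Multiset.count_ne_zero.2 he
  by_cases hf : f = e <;> simp [mem_openEdges, hf, he]

/-- The total multiplicity in excess of two; an entry bounded by `K` contributes at most one factor
`K` to an expectation for each unit of it. -/
def surplus (m : Multiset (Sym2 V)) : ℕ := ∑ e, (m.count e - 2)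

lemma surplus_cons (m : Multiset (Sym2 V)) (e : Sym2 V) :
    surplus (e ::ₘ m) = surplus m + if 2 ≤ m.count e then 1 else 0 := by
  calc surplus (e ::ₘ m)
      = ∑ f, ((m.count f - 2) + if f = e then (if 2 ≤ m.count e then 1 else 0) else 0) :=
        Finset.sum_congr rfl fun f _ => by
          rw [Multiset.count_cons]
          grind
    _ = _ := by simp [Finset.sum_add_distrib, surplus]

/-- The vertices visited by a walk with past `m` and current vertex `u`. -/
def visited (m : Multiset (Sym2 V)) (u : V) : Finset V :=
  insert u (Finset.univ.filter fun v => ∃ e ∈ m, v ∈ e)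

lemma mem_visited_of_mem {m : Multiset (Sym2 V)} {u w : V} (h : s(u, w) ∈ m) :
    w ∈ visited m u :=
  Finset.mem_insert_of_mem <|
    Finset.mem_filter.2 ⟨Finset.mem_univ w, s(u, w), h, Sym2.mem_mk_right u w⟩

lemma card_visited_cons_le (m : Multiset (Sym2 V)) (u w : V) :
    #(visited (s(u, w) ::ₘ m) w) ≤ #(visited m u) + 1 := by
  refine (Finset.card_le_card (t := insert w (visited m u)) fun v hv => ?_).trans
    (Finset.card_insert_le _ _)
  simp only [visited, Multiset.mem_cons, Finset.mem_insert, Finset.mem_filter, Finset.mem_univ,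
    true_and, exists_eq_or_imp, Sym2.mem_iff] at hv ⊢
  tauto

lemma degree_openEdges_le_card_visited (m : Multiset (Sym2 V)) (u : V) :
    degree (openEdges m) u ≤ #(visited m u) := by
  refine Finset.card_le_card fun w hw => mem_visited_of_mem ?_
  rw [Finset.mem_filter, mem_openEdges] at hw
  exact Multiset.count_pos.1 (hw.2 ▸ one_pos)

lemma degree_openEdges_eq_zero_of_notMem_visited {m : Multiset (Sym2 V)} {u w : V}
    (hw : w ∉ visited m u) : degree (openEdges m) w = 0 := by
  refine Finset.card_eq_zero.2 (Finset.filter_eq_empty_iff.2 fun z _ hz => hw ?_)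
  refine Finset.mem_insert_of_mem (Finset.mem_filter.2 ⟨Finset.mem_univ w, s(w, z), ?_, by simp⟩)
  exact Multiset.count_pos.1 (mem_openEdges.1 hz ▸ one_pos)

/-- The bound on the contribution of a past `m` ending at `u` to the expectation of a trace of a
power, relative to a factor of order `q` for every later step: `K` bounds the entries of the matrix,
`L` the number of visited vertices, and `q ^ 2` the number of entries in a row. -/
noncomputable def pastWeight (K L q : ℝ) (m : Multiset (Sym2 V)) (u : V) : ℝ :=
  K ^ surplus m * L ^ potential (openEdges m) u / q ^ #(openEdges m)

variable {K L q : ℝ} {m : Multiset (Sym2 V)} {u w : V}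

lemma pastWeight_nonneg (hK : 0 ≤ K) (hL : 1 ≤ L) (hq : 0 < q) : 0 ≤ pastWeight K L q m u := by
  unfold pastWeight
  positivity

lemma pastWeight_cons_le_of_notMem (hK : 0 ≤ K) (hL : 1 ≤ L) (hq : 0 < q) {n : ℕ}
    (he : s(u, w) ∉ m)
    (hn : potential (insert s(u, w) (openEdges m)) w ≤ potential (openEdges m) u + n) :
    pastWeight K L q (s(u, w) ::ₘ m) w ≤ pastWeight K L q m u * (L ^ n / q) := by
  have hcount : m.count s(u, w) = 0 := Multiset.count_eq_zero_of_notMem he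
  have hopen : s(u, w) ∉ openEdges m := by simp [mem_openEdges, hcount]
  calc pastWeight K L q (s(u, w) ::ₘ m) w
      = K ^ surplus m * L ^ potential (insert s(u, w) (openEdges m)) w /
          q ^ (#(openEdges m) + 1) := by
        rw [pastWeight, surplus_cons, openEdges_cons_of_notMem he,
          Finset.card_insert_of_notMem hopen, hcount]
        simp
    _ ≤ K ^ surplus m * L ^ (potential (openEdges m) u + n) / q ^ (#(openEdges m) + 1) := by
        gcongr
    _ = pastWeight K L q m u * (L ^ n / q) := by
        rw [pastWeight, pow_add, pow_succ]
        field_simp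

lemma pastWeight_cons_le_of_notMem_visited (hK : 0 ≤ K) (hL : 1 ≤ L) (hq : 0 < q)
    (hw : w ∉ visited m u) :
    pastWeight K L q (s(u, w) ::ₘ m) w ≤ pastWeight K L q m u * (1 / q) := by
  have he : s(u, w) ∉ m := fun he => hw (mem_visited_of_mem he)
  have hopen : s(u, w) ∉ openEdges m := by simp [mem_openEdges, he]
  simpa using pastWeight_cons_le_of_notMem (n := 0) hK hL hq he <|
    potential_insert_le_of_degree_eq_zero hopen (degree_openEdges_eq_zero_of_notMem_visited hw)

lemma pastWeight_cons_le_of_two_le_count (hK : 0 ≤ K) (hL : 1 ≤ L) (hq : 0 < q)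
    (he : 2 ≤ m.count s(u, w)) :
    pastWeight K L q (s(u, w) ::ₘ m) w ≤ pastWeight K L q m u * (K * L) := by
  have hmem : s(u, w) ∈ m := Multiset.count_pos.1 (by omega)
  have hopen : s(u, w) ∉ openEdges m := by rw [mem_openEdges]; omega
  calc pastWeight K L q (s(u, w) ::ₘ m) w
      = K ^ (surplus m + 1) * L ^ potential (openEdges m) w / q ^ #(openEdges m) := by
        rw [pastWeight, surplus_cons, if_pos he, openEdges_cons_of_mem hmem,
          Finset.erase_eq_of_notMem hopen]
    _ ≤ K ^ (surplus m + 1) * L ^ (potential (openEdges m) u + 1) / q ^ #(openEdges m) := by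
        gcongr
        exact potential_le_add_one _ u w
    _ = pastWeight K L q m u * (K * L) := by
        rw [pastWeight, pow_succ, pow_succ]
        ring

-- The potential pays for the choice among the open edges at `u`.
lemma pastWeight_cons_mul_degree_le (hK : 0 ≤ K) (hL : 1 ≤ L) (hq : 0 < q)
    (hu : (#(visited m u) : ℝ) ≤ L) (he : s(u, w) ∈ openEdges m) :
    pastWeight K L q (s(u, w) ::ₘ m) w * degree (openEdges m) u ≤ pastWeight K L q m u * q := by
  have hcount : m.count s(u, w) = 1 := mem_openEdges.1 he
  have hmem : s(u, w) ∈ m := Multiset.count_pos.1 (by omega)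
  have hpotential := potential_erase_add_le he
  have hdegree : (degree (openEdges m) u : ℝ) ≤
      L ^ (if 2 ≤ degree (openEdges m) u then 1 else 0) := by
    split_ifs with h
    · rw [pow_one]
      exact le_trans (mod_cast degree_openEdges_le_card_visited m u) hu
    · rw [pow_zero]
      exact_mod_cast Nat.le_of_lt_succ (not_le.1 h)
  have hcard : #(openEdges m) = #((openEdges m).erase s(u, w)) + 1 :=
    (Finset.card_erase_add_one he).symm
  calc pastWeight K L q (s(u, w) ::ₘ m) w * degree (openEdges m) u
      ≤ K ^ surplus m * L ^ potential ((openEdges m).erase s(u, w)) w /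
          q ^ #((openEdges m).erase s(u, w)) *
          L ^ (if 2 ≤ degree (openEdges m) u then 1 else 0) := by
        rw [pastWeight, surplus_cons, hcount, openEdges_cons_of_mem hmem]
        exact mul_le_mul_of_nonneg_left hdegree (by positivity)
    _ = K ^ surplus m * L ^ (potential ((openEdges m).erase s(u, w)) w +
          if 2 ≤ degree (openEdges m) u then 1 else 0) / q ^ #((openEdges m).erase s(u, w)) := by
        rw [pow_add]
        ring
    _ ≤ K ^ surplus m * L ^ potential (openEdges m) u / q ^ #((openEdges m).erase s(u, w)) := by
        gcongr
    _ = pastWeight K L q m u * q := by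
        rw [pastWeight, hcard, pow_succ]
        field_simp

lemma sum_pastWeight_cons_openEdges_le (hK : 0 ≤ K) (hL : 1 ≤ L) (hq : 0 < q)
    (hu : (#(visited m u) : ℝ) ≤ L) :
    ∑ w with s(u, w) ∈ openEdges m, pastWeight K L q (s(u, w) ::ₘ m) w ≤
      pastWeight K L q m u * q := by
  have hW := pastWeight_nonneg (m := m) (u := u) hK hL hq
  obtain hd | hd := Nat.eq_zero_or_pos (degree (openEdges m) u)
  · rw [Finset.card_eq_zero.1 hd, Finset.sum_empty]
    positivity
  · have hd' : (0 : ℝ) < degree (openEdges m) u := mod_cast hd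
    calc ∑ w with s(u, w) ∈ openEdges m, pastWeight K L q (s(u, w) ::ₘ m) w
        ≤ degree (openEdges m) u • (pastWeight K L q m u * q / degree (openEdges m) u) :=
          Finset.sum_le_card_nsmul _ _ _ fun w hw => (le_div_iff₀ hd').2 <|
            pastWeight_cons_mul_degree_le hK hL hq hu (Finset.mem_filter.1 hw).2
      _ = pastWeight K L q m u * q := by
          rw [nsmul_eq_mul, mul_div_cancel₀ _ hd'.ne']

lemma pastWeight_cons_le (hK : 0 ≤ K) (hL : 1 ≤ L) (hq : 0 < q) :
    pastWeight K L q (s(u, w) ::ₘ m) w ≤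
      (if s(u, w) ∈ openEdges m then pastWeight K L q (s(u, w) ::ₘ m) w else 0) +
        pastWeight K L q m u * (1 / q) +
        if w ∈ visited m u then pastWeight K L q m u * (L ^ 2 / q + K * L) else 0 := by
  have hW := pastWeight_nonneg (m := m) (u := u) hK hL hq
  have hnew : 0 ≤ pastWeight K L q m u * (1 / q) := by positivity
  have hchord : 0 ≤ pastWeight K L q m u * (L ^ 2 / q) := by positivity
  have hrepeat : 0 ≤ pastWeight K L q m u * (K * L) := by positivity
  rw [mul_add]
  by_cases hopen : s(u, w) ∈ openEdges m
  · rw [if_pos hopen]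
    split_ifs <;> linarith
  rw [if_neg hopen]
  by_cases hw : w ∈ visited m u
  · rw [if_pos hw]
    obtain he | he := em (s(u, w) ∈ m)
    · have hcount : 2 ≤ m.count s(u, w) := by
        have := Multiset.count_pos.2 he
        rw [mem_openEdges] at hopen
        omega
      linarith [pastWeight_cons_le_of_two_le_count (K := K) (L := L) hK hL hq hcount]
    · linarith [pastWeight_cons_le_of_notMem (K := K) (L := L) hK hL hq he
        (potential_insert_le hopen)]
  · rw [if_neg hw]
    linarith [pastWeight_cons_le_of_notMem_visited (K := K) (L := L) hK hL hq hw]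

/-- An admissible growth factor per step, in units of `q`: one unit for the steps to new vertices,
one for the steps that close an open edge, and lower order terms for all other steps. -/
noncomputable def stepFactor (K L q : ℝ) : ℝ := 2 + L ^ 3 / q ^ 2 + L ^ 2 * K / q

lemma stepFactor_nonneg (hK : 0 ≤ K) (hL : 0 ≤ L) (hq : 0 < q) : 0 ≤ stepFactor K L q := by
  unfold stepFactor
  positivity

lemma sum_pastWeight_cons_le (hK : 0 ≤ K) (hL : 1 ≤ L) (hq : 0 < q)
    (hu : (#(visited m u) : ℝ) ≤ L) {A : Finset V} (hA : (#A : ℝ) ≤ q ^ 2) :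
    ∑ w ∈ A, pastWeight K L q (s(u, w) ::ₘ m) w ≤
      pastWeight K L q m u * (stepFactor K L q * q) := by
  set W := pastWeight K L q m u
  have hW : 0 ≤ W := pastWeight_nonneg hK hL hq
  have hclose : ∑ w ∈ A,
      (if s(u, w) ∈ openEdges m then pastWeight K L q (s(u, w) ::ₘ m) w else 0) ≤ W * q := by
    refine le_trans ?_ (sum_pastWeight_cons_openEdges_le hK hL hq hu)
    rw [Finset.sum_filter]
    refine Finset.sum_le_sum_of_subset_of_nonneg (Finset.subset_univ A) fun w _ _ => ?_
    split_ifs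
    exacts [pastWeight_nonneg hK hL hq, le_rfl]
  have hnew : ∑ w ∈ A, W * (1 / q) ≤ W * q := by
    calc ∑ w ∈ A, W * (1 / q) = W * (#A / q) := by
          rw [Finset.sum_const, nsmul_eq_mul]
          ring
      _ ≤ W * (q ^ 2 / q) := by gcongr
      _ = W * q := by rw [sq, mul_div_cancel_right₀ _ hq.ne']
  have hvisited : ∑ w ∈ A, (if w ∈ visited m u then W * (L ^ 2 / q + K * L) else 0) ≤
      L * (W * (L ^ 2 / q + K * L)) := by
    rw [← Finset.sum_filter, Finset.sum_const, nsmul_eq_mul]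
    gcongr
    refine le_trans (mod_cast Finset.card_le_card fun w hw => ?_) hu
    exact (Finset.mem_filter.1 hw).2
  calc ∑ w ∈ A, pastWeight K L q (s(u, w) ::ₘ m) w
      ≤ W * q + W * q + L * (W * (L ^ 2 / q + K * L)) := by
        refine (Finset.sum_le_sum fun w _ => pastWeight_cons_le hK hL hq).trans ?_
        rw [Finset.sum_add_distrib, Finset.sum_add_distrib]
        exact add_le_add (add_le_add hclose hnew) hvisited
    _ = W * (stepFactor K L q * q) := by
        rw [stepFactor]
        field_simp
        ring

end Walks

section Expectation

/-- Independent random variables with mean zero and second moment at most one; the entries of the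
matrices below, indexed by the unordered pairs of vertices, form such a family. -/
structure IsNormalizedFamily {ι Ω : Type*} [MeasurableSpace Ω] (P : Measure Ω)
    (x : ι → Ω → ℝ) : Prop where
  measurable : ∀ i, Measurable (x i)
  indep : iIndepFun x P
  mean_zero : ∀ i, ∫ ω, x i ω ∂P = 0
  second_moment_le_one : ∀ i, ∫ ω, x i ω ^ 2 ∂P ≤ 1

variable {ι V Ω : Type*} [MeasurableSpace Ω] {P : Measure Ω} [IsProbabilityMeasure P] {K : ℝ}

lemma integrable_pow_of_abs_le {X : Ω → ℝ} (hX : Measurable X) (hK : ∀ ω, |X ω| ≤ K) (n : ℕ) :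
    Integrable (fun ω => X ω ^ n) P :=
  .of_bound (C := K ^ n) (hX.pow_const n).aestronglyMeasurable <| .of_forall fun ω => by
    rw [Real.norm_eq_abs, abs_pow]
    exact pow_le_pow_left₀ (abs_nonneg _) (hK ω) n

lemma integrable_prod_map {x : ι → Ω → ℝ} (hx : ∀ i, Measurable (x i))
    (hK : ∀ i ω, |x i ω| ≤ K) (m : Multiset ι) :
    Integrable (fun ω => (m.map fun i => x i ω).prod) P := by
  induction m using Multiset.induction with
  | empty => simp
  | cons i m ih =>
    simp only [Multiset.map_cons, Multiset.prod_cons]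
    exact ih.bdd_mul (hx i).aestronglyMeasurable (.of_forall fun ω => hK i ω)

lemma abs_integral_pow_le {X : Ω → ℝ} (hX : Measurable X) (hK : ∀ ω, |X ω| ≤ K) (hK0 : 0 ≤ K)
    (h2 : ∫ ω, X ω ^ 2 ∂P ≤ 1) {n : ℕ} (hn : n ≠ 1) :
    |∫ ω, X ω ^ n ∂P| ≤ K ^ (n - 2) := by
  obtain rfl | hn : n = 0 ∨ 2 ≤ n := by omega
  · simp
  obtain ⟨k, rfl⟩ := Nat.exists_eq_add_of_le' hn
  rw [Nat.add_sub_cancel]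
  calc |∫ ω, X ω ^ (k + 2) ∂P| ≤ ∫ ω, K ^ k * X ω ^ 2 ∂P := by
        rw [← Real.norm_eq_abs]
        refine norm_integral_le_of_norm_le ((integrable_pow_of_abs_le hX hK 2).const_mul _)
          (.of_forall fun ω => ?_)
        rw [Real.norm_eq_abs, pow_add, abs_mul, abs_pow, abs_of_nonneg (sq_nonneg (X ω))]
        gcongr
        exact hK ω
    _ = K ^ k * ∫ ω, X ω ^ 2 ∂P := integral_const_mul _ _
    _ ≤ K ^ k := mul_le_of_le_one_right (by positivity) h2

lemma IsNormalizedFamily.abs_integral_prod_map_le [Fintype V] [DecidableEq V]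
    {x : Sym2 V → Ω → ℝ} (hx : IsNormalizedFamily P x) (hK : ∀ e ω, |x e ω| ≤ K) (hK0 : 0 ≤ K)
    (m : Multiset (Sym2 V)) :
    |∫ ω, (m.map fun e => x e ω).prod ∂P| ≤ if openEdges m = ∅ then K ^ surplus m else 0 := by
  have hfactor : ∫ ω, (m.map fun e => x e ω).prod ∂P = ∏ e, ∫ ω, x e ω ^ m.count e ∂P := by
    have hmap (ω : Ω) : (m.map fun e => x e ω).prod = ∏ e, x e ω ^ m.count e := by
      rw [Finset.prod_multiset_map_count]
      refine Finset.prod_subset (Finset.subset_univ _) fun e _ he => ?_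
      rw [Multiset.count_eq_zero.2 (by simpa using he), pow_zero]
    simp_rw [hmap]
    exact (hx.indep.comp (fun e t => t ^ m.count e) fun e => measurable_id.pow_const _)
      |>.integral_fun_prod_eq_prod_integral fun e =>
        ((hx.measurable e).pow_const _).aestronglyMeasurable
  rw [hfactor, Finset.abs_prod]
  split_ifs with hopen
  · rw [surplus, ← Finset.prod_pow_eq_pow_sum]
    refine Finset.prod_le_prod (fun _ _ => abs_nonneg _) fun e _ => ?_
    have hcount : m.count e ≠ 1 := fun h => by simpa [hopen] using mem_openEdges.2 h
    exact abs_integral_pow_le (hx.measurable e) (hK e) hK0 (hx.second_moment_le_one e) hcount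
  · obtain ⟨e, he⟩ := Finset.nonempty_iff_ne_empty.2 hopen
    refine (Finset.prod_eq_zero (Finset.mem_univ e) ?_).le
    rw [mem_openEdges.1 he]
    simpa using hx.mean_zero e

/-- The symmetric matrix whose entries are given by a function on unordered pairs of indices. -/
def edgeMatrix {V : Type*} (a : Sym2 V → ℝ) : Matrix V V ℝ := Matrix.of fun u w => a s(u, w)

variable [Fintype V] [DecidableEq V]

lemma prod_map_mul_edgeMatrix_pow_succ (a : Sym2 V → ℝ) (m : Multiset (Sym2 V)) (r : ℕ) (u v : V) :
    (m.map a).prod * (edgeMatrix a ^ (r + 1)) u v =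
      ∑ w, ((s(u, w) ::ₘ m).map a).prod * (edgeMatrix a ^ r) w v := by
  rw [pow_succ', Matrix.mul_apply, Finset.mul_sum]
  refine Finset.sum_congr rfl fun w _ => ?_
  rw [Multiset.map_cons, Multiset.prod_cons, edgeMatrix, Matrix.of_apply]
  ring

variable {x : Sym2 V → Ω → ℝ}

lemma integrable_prod_map_mul_edgeMatrix_pow (hx : ∀ e, Measurable (x e))
    (hK : ∀ e ω, |x e ω| ≤ K) (r : ℕ) (m : Multiset (Sym2 V)) (u v : V) :
    Integrable
      (fun ω => (m.map fun e => x e ω).prod * (edgeMatrix (fun e => x e ω) ^ r) u v) P := by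
  induction r generalizing m u with
  | zero => simpa using (integrable_prod_map hx hK m).mul_const _
  | succ r ih =>
    simp_rw [prod_map_mul_edgeMatrix_pow_succ]
    exact integrable_finsetSum _ fun w _ => ih _ _

lemma IsNormalizedFamily.abs_integral_prod_map_mul_one_le (hx : IsNormalizedFamily P x)
    (hK : ∀ e ω, |x e ω| ≤ K) {L q : ℝ} (hK0 : 0 ≤ K) (hL : 1 ≤ L) (hq : 0 < q)
    (m : Multiset (Sym2 V)) (u v : V) :
    |∫ ω, (m.map fun e => x e ω).prod * (1 : Matrix V V ℝ) u v ∂P| ≤ pastWeight K L q m u := by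
  calc |∫ ω, (m.map fun e => x e ω).prod * (1 : Matrix V V ℝ) u v ∂P|
      = |∫ ω, (m.map fun e => x e ω).prod ∂P| * |(1 : Matrix V V ℝ) u v| := by
        rw [integral_mul_const, abs_mul]
    _ ≤ |∫ ω, (m.map fun e => x e ω).prod ∂P| * 1 := by
        gcongr
        rw [Matrix.one_apply]
        split_ifs <;> simp
    _ ≤ if openEdges m = ∅ then K ^ surplus m else 0 := by
        rw [mul_one]
        exact hx.abs_integral_prod_map_le hK hK0 m
    _ ≤ pastWeight K L q m u := by
        split_ifs with hopen
        · rw [pastWeight, hopen, Finset.card_empty, pow_zero, div_one]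
          exact le_mul_of_one_le_right (by positivity) (one_le_pow₀ hL)
        · exact pastWeight_nonneg hK0 hL hq

lemma IsNormalizedFamily.abs_integral_prod_map_mul_edgeMatrix_pow_le (hx : IsNormalizedFamily P x)
    (hK : ∀ e ω, |x e ω| ≤ K) {L q : ℝ} (hK0 : 0 ≤ K) (hL : 1 ≤ L) (hq : 0 < q)
    (hsupp : ∀ u, ({w | x s(u, w) ≠ 0}.ncard : ℝ) ≤ q ^ 2)
    (r : ℕ) (m : Multiset (Sym2 V)) (u v : V) (hr : (#(visited m u) + r : ℝ) ≤ L) :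
    |∫ ω, (m.map fun e => x e ω).prod * (edgeMatrix (fun e => x e ω) ^ r) u v ∂P| ≤
      pastWeight K L q m u * (stepFactor K L q * q) ^ r := by
  induction r generalizing m u with
  | zero =>
    have h := hx.abs_integral_prod_map_mul_one_le hK hK0 hL hq m u v
    simpa only [pow_zero, mul_one] using h
  | succ r ih =>
    classical
    push_cast at hr
    let I (w : V) : ℝ := ∫ ω, ((s(u, w) ::ₘ m).map fun e => x e ω).prod *
      (edgeMatrix (fun e => x e ω) ^ r) w v ∂P
    have hstep : 0 ≤ stepFactor K L q * q :=
      mul_nonneg (stepFactor_nonneg hK0 (by positivity) hq) hq.le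
    have hI : ∀ w, |I w| ≤ pastWeight K L q (s(u, w) ::ₘ m) w * (stepFactor K L q * q) ^ r := by
      refine fun w => ih _ w ?_
      have : (#(visited (s(u, w) ::ₘ m) w) : ℝ) ≤ #(visited m u) + 1 := by
        exact_mod_cast card_visited_cons_le m u w
      linarith
    have hI_zero : ∀ w, x s(u, w) = 0 → I w = 0 := fun w hw => by simp [I, hw]
    have hcard : (#{w | x s(u, w) ≠ 0} : ℝ) ≤ q ^ 2 := by
      rw [← Set.ncard_coe_finset]
      simpa using hsupp u
    simp_rw [prod_map_mul_edgeMatrix_pow_succ]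
    rw [integral_finsetSum _ fun w _ =>
      integrable_prod_map_mul_edgeMatrix_pow hx.measurable hK r _ w v]
    calc |∑ w, I w| = |∑ w with x s(u, w) ≠ 0, I w| := by
          rw [Finset.sum_filter_of_ne (p := fun w => x s(u, w) ≠ 0)
            fun w _ hw hzero => hw (hI_zero w hzero)]
      _ ≤ ∑ w with x s(u, w) ≠ 0, |I w| := Finset.abs_sum_le_sum_abs _ _
      _ ≤ ∑ w with x s(u, w) ≠ 0,
            pastWeight K L q (s(u, w) ::ₘ m) w * (stepFactor K L q * q) ^ r :=
          Finset.sum_le_sum fun w _ => hI w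
      _ ≤ pastWeight K L q m u * (stepFactor K L q * q) * (stepFactor K L q * q) ^ r := by
          rw [← Finset.sum_mul]
          gcongr
          refine sum_pastWeight_cons_le hK0 hL hq ?_ hcard
          linarith [(Nat.cast_nonneg r : (0 : ℝ) ≤ r)]
      _ = pastWeight K L q m u * (stepFactor K L q * q) ^ (r + 1) := by
          rw [pow_succ', mul_assoc]

lemma integrable_trace_edgeMatrix_pow (hx : ∀ e, Measurable (x e)) (hK : ∀ e ω, |x e ω| ≤ K)
    (r : ℕ) : Integrable (fun ω => (edgeMatrix (fun e => x e ω) ^ r).trace) P :=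
  integrable_finsetSum _ fun u _ => by
    simpa using integrable_prod_map_mul_edgeMatrix_pow (P := P) hx hK r 0 u u

theorem IsNormalizedFamily.integral_trace_edgeMatrix_pow_le (hx : IsNormalizedFamily P x)
    (hK : ∀ e ω, |x e ω| ≤ K) {L q : ℝ} (hK0 : 0 ≤ K) (hq : 0 < q)
    (hsupp : ∀ u, ({w | x s(u, w) ≠ 0}.ncard : ℝ) ≤ q ^ 2) {r : ℕ} (hr : (1 + r : ℝ) ≤ L) :
    ∫ ω, (edgeMatrix (fun e => x e ω) ^ r).trace ∂P ≤
      Fintype.card V * (stepFactor K L q * q) ^ r := by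
  have hL : 1 ≤ L := by linarith [(Nat.cast_nonneg r : (0 : ℝ) ≤ r)]
  have hdiag (u : V) : ∫ ω, (edgeMatrix (fun e => x e ω) ^ r) u u ∂P ≤
      (stepFactor K L q * q) ^ r := by
    have hvisited : visited (0 : Multiset (Sym2 V)) u = {u} := by simp [visited]
    have hweight : pastWeight K L q 0 u = 1 := by
      simp [pastWeight, surplus, potential, openEdges, degree]
    have h := hx.abs_integral_prod_map_mul_edgeMatrix_pow_le hK hK0 hL hq hsupp r 0 u u
      (by simpa [hvisited] using hr)
    rw [hweight, one_mul] at h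
    simpa using (le_abs_self _).trans h
  have hint (u : V) : Integrable (fun ω => (edgeMatrix (fun e => x e ω) ^ r) u u) P := by
    simpa using integrable_prod_map_mul_edgeMatrix_pow (P := P) hx.measurable hK r 0 u u
  simp only [Matrix.trace, Matrix.diag_apply]
  rw [integral_finsetSum _ fun u _ => hint u]
  refine (Finset.sum_le_card_nsmul _ _ _ fun u _ => hdiag u).trans_eq ?_
  rw [nsmul_eq_mul, Finset.card_univ]

end Expectation

section Norm

open scoped Matrix.Norms.L2Operator

variable {n : Type*} [Fintype n] [DecidableEq n] {M : Matrix n n ℝ}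

lemma norm_sq_le_sum_sq (M : Matrix n n ℝ) : ‖M‖ ^ 2 ≤ ∑ i, ∑ j, M i j ^ 2 := by
  have hnonneg : 0 ≤ ∑ i, ∑ j, M i j ^ 2 := by positivity
  rw [← Real.le_sqrt (norm_nonneg M) hnonneg, Matrix.cstar_norm_def]
  refine ContinuousLinearMap.opNorm_le_bound _ (Real.sqrt_nonneg _) fun v => ?_
  refine le_of_sq_le_sq ?_ (by positivity)
  rw [mul_pow, Real.sq_sqrt hnonneg, EuclideanSpace.norm_sq_eq, EuclideanSpace.norm_sq_eq,
    Finset.sum_mul]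
  refine Finset.sum_le_sum fun i _ => ?_
  simp only [Real.norm_eq_abs, sq_abs, Matrix.ofLp_toEuclideanCLM, Matrix.mulVec, dotProduct]
  exact Finset.sum_mul_sq_le_sq_mul_sq _ _ _

lemma norm_le_card_mul {a : ℝ} (ha : 0 ≤ a) (hM : ∀ i j, |M i j| ≤ a) :
    ‖M‖ ≤ Fintype.card n * a := by
  refine le_of_sq_le_sq ?_ (by positivity)
  calc ‖M‖ ^ 2 ≤ ∑ i, ∑ j, M i j ^ 2 := norm_sq_le_sum_sq M
    _ ≤ ∑ _i : n, ∑ _j : n, a ^ 2 := by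
        refine Finset.sum_le_sum fun i _ => Finset.sum_le_sum fun j _ => ?_
        exact sq_le_sq.2 ((hM i j).trans (le_abs_self a))
    _ = (Fintype.card n * a) ^ 2 := by
        simp only [Finset.sum_const, Finset.card_univ, nsmul_eq_mul]
        ring

lemma norm_pow_le_norm_pow_of_isSelfAdjoint {A : Type*} [NormedRing A] [StarRing A] [CStarRing A]
    {a : A} (ha : IsSelfAdjoint a) {p : ℕ} (hp : p ≠ 0) : ‖a‖ ^ p ≤ ‖a ^ p‖ := by
  obtain h0 | hpos := (norm_nonneg a).eq_or_lt
  · rw [← h0, zero_pow hp]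
    exact norm_nonneg _
  obtain ⟨k, hk⟩ := Nat.exists_eq_add_of_le (Nat.lt_two_pow_self (n := p)).le
  refine le_of_mul_le_mul_right ?_ (pow_pos hpos k)
  calc ‖a‖ ^ p * ‖a‖ ^ k = ‖a ^ p * a ^ k‖ := by
        rw [← pow_add, ← pow_add, ← hk, ha.norm_pow_two_pow]
    _ ≤ ‖a ^ p‖ * ‖a‖ ^ k := by
        obtain rfl | hk0 := Nat.eq_zero_or_pos k
        · simp
        · exact (norm_mul_le _ _).trans (by gcongr; exact norm_pow_le' a hk0)

lemma trace_pow_two_mul (hM : M.IsSymm) (p : ℕ) :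
    (M ^ (2 * p)).trace = ∑ i, ∑ j, (M ^ p) i j ^ 2 := by
  rw [two_mul, pow_add]
  simp only [Matrix.trace, Matrix.diag_apply, Matrix.mul_apply]
  refine Finset.sum_congr rfl fun i _ => Finset.sum_congr rfl fun j _ => ?_
  rw [(hM.pow p).apply i j, sq]

lemma norm_pow_two_mul_le_trace (hM : M.IsSymm) {p : ℕ} (hp : p ≠ 0) :
    ‖M‖ ^ (2 * p) ≤ (M ^ (2 * p)).trace := by
  have hself : IsSelfAdjoint M := Matrix.isHermitian_iff_isSelfAdjoint.1 <| by
    rwa [Matrix.IsHermitian, Matrix.conjTranspose_eq_transpose_of_trivial]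
  calc ‖M‖ ^ (2 * p) = (‖M‖ ^ p) ^ 2 := by rw [mul_comm, pow_mul]
    _ ≤ ‖M ^ p‖ ^ 2 := by
        gcongr
        exact norm_pow_le_norm_pow_of_isSelfAdjoint hself hp
    _ ≤ (M ^ (2 * p)).trace := trace_pow_two_mul hM p ▸ norm_sq_le_sum_sq _

end Norm

section Truncation

/-- The truncation of `X` to `(-c, c]`, recentred to have mean zero. -/
noncomputable def centeredTruncation {Ω : Type*} [MeasurableSpace Ω] (P : Measure Ω) (X : Ω → ℝ)
    (c : ℝ) : Ω → ℝ :=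
  fun ω => truncation X c ω - ∫ ω', truncation X c ω' ∂P

lemma abs_truncation_sub_self_le {Ω : Type*} (X : Ω → ℝ) {c : ℝ} (hc : 0 < c) (k : ℕ) (ω : Ω) :
    |truncation X c ω - X ω| ≤ |X ω| ^ (k + 1) / c ^ k := by
  obtain h | h := lt_or_ge |X ω| c
  · rw [truncation_eq_self h, sub_self, abs_zero]
    positivity
  · have hdiff : |truncation X c ω - X ω| ≤ |X ω| := by
      simp only [truncation, Function.comp_apply, Set.indicator_apply, id]
      split_ifs <;> simp
    calc |truncation X c ω - X ω| ≤ |X ω| := hdiff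
      _ ≤ |X ω| * (|X ω| ^ k / c ^ k) := by
          refine le_mul_of_one_le_right (abs_nonneg _) ?_
          rw [one_le_div (by positivity)]
          gcongr
      _ = |X ω| ^ (k + 1) / c ^ k := by rw [pow_succ', mul_div_assoc]

variable {ι Ω : Type*} [MeasurableSpace Ω] {P : Measure Ω} {X : Ω → ℝ} {c : ℝ}

lemma centeredTruncation_zero : centeredTruncation P 0 c = 0 := by
  ext ω
  simp [centeredTruncation, truncation, Set.indicator_apply]

variable [IsProbabilityMeasure P]

lemma abs_integral_truncation_le_bound (X : Ω → ℝ) (hc : 0 ≤ c) :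
    |∫ ω, truncation X c ω ∂P| ≤ c := by
  have hbound : ∀ᵐ ω ∂P, ‖truncation X c ω‖ ≤ |c| := .of_forall (abs_truncation_le_bound X c)
  simpa [abs_of_nonneg hc] using norm_integral_le_of_norm_le_const hbound

lemma abs_centeredTruncation_le (X : Ω → ℝ) (hc : 0 ≤ c) (ω : Ω) :
    |centeredTruncation P X c ω| ≤ 2 * c := by
  have hbound : |truncation X c ω| ≤ c := by
    simpa only [abs_of_nonneg hc] using abs_truncation_le_bound X c ω
  calc |centeredTruncation P X c ω|
      ≤ |truncation X c ω| + |∫ ω, truncation X c ω ∂P| := abs_sub _ _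
    _ ≤ 2 * c := by linarith [abs_integral_truncation_le_bound (P := P) X hc]

lemma integral_centeredTruncation (hX : AEStronglyMeasurable X P) (c : ℝ) :
    ∫ ω, centeredTruncation P X c ω ∂P = 0 := by
  simp [centeredTruncation, integral_sub hX.integrable_truncation (integrable_const _)]

lemma integral_centeredTruncation_sq_le (hX : MemLp X 2 P) (c : ℝ) :
    ∫ ω, centeredTruncation P X c ω ^ 2 ∂P ≤ ∫ ω, X ω ^ 2 ∂P := by
  have hmeas := hX.aestronglyMeasurable.truncation (A := c)
  calc ∫ ω, centeredTruncation P X c ω ^ 2 ∂P = Var[truncation X c; P] :=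
        (variance_eq_integral hmeas.aemeasurable).symm
    _ ≤ ∫ ω, truncation X c ω ^ 2 ∂P := variance_le_expectation_sq hmeas
    _ ≤ ∫ ω, X ω ^ 2 ∂P :=
        integral_mono hX.aestronglyMeasurable.memLp_truncation.integrable_sq hX.integrable_sq
          fun ω => sq_le_sq.2 (abs_truncation_le_abs_self X c ω)

lemma IsNormalizedFamily.centeredTruncation {x : ι → Ω → ℝ} (hx : IsNormalizedFamily P x)
    (hx2 : ∀ i, MemLp (x i) 2 P) (c : ℝ) :
    IsNormalizedFamily P fun i => centeredTruncation P (x i) c where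
  measurable i :=
    ((measurable_id.indicator measurableSet_Ioc).comp (hx.measurable i)).sub_const _
  indep := hx.indep.comp
    (fun i t => (Set.Ioc (-c) c).indicator id t - ∫ ω, truncation (x i) c ω ∂P)
    fun _ => (measurable_id.indicator measurableSet_Ioc).sub_const _
  mean_zero i := integral_centeredTruncation (hx.measurable i).aestronglyMeasurable c
  second_moment_le_one i :=
    (integral_centeredTruncation_sq_le (hx2 i) c).trans (hx.second_moment_le_one i)

lemma abs_integral_truncation_le (hX : Integrable X P) (hX0 : ∫ ω, X ω ∂P = 0) {k : ℕ}
    (hXk : Integrable (fun ω => |X ω| ^ (k + 1)) P) (hc : 0 < c) :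
    |∫ ω, truncation X c ω ∂P| ≤ (∫ ω, |X ω| ^ (k + 1) ∂P) / c ^ k := by
  have hbias : ∫ ω, truncation X c ω ∂P = ∫ ω, (truncation X c ω - X ω) ∂P := by
    rw [integral_sub hX.aestronglyMeasurable.integrable_truncation hX, hX0, sub_zero]
  rw [hbias, ← integral_div, ← Real.norm_eq_abs]
  exact norm_integral_le_of_norm_le (hXk.div_const _)
    (.of_forall fun ω => abs_truncation_sub_self_le X hc k ω)

end Truncation

section TailBound

lemma measureReal_le_abs_le {Ω : Type*} [MeasurableSpace Ω] {P : Measure Ω} [IsFiniteMeasure P]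
    {X : Ω → ℝ} {k : ℕ} (hX : Integrable (fun ω => |X ω| ^ k) P) {c : ℝ} (hc : 0 < c) :
    P.real {ω | c ≤ |X ω|} ≤ (∫ ω, |X ω| ^ k ∂P) / c ^ k := by
  rw [le_div_iff₀' (by positivity)]
  calc c ^ k * P.real {ω | c ≤ |X ω|} ≤ c ^ k * P.real {ω | c ^ k ≤ |X ω| ^ k} := by
        refine mul_le_mul_of_nonneg_left (measureReal_mono fun ω hω => ?_) (by positivity)
        exact pow_le_pow_left₀ hc.le hω k
    _ ≤ ∫ ω, |X ω| ^ k ∂P :=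
        mul_meas_ge_le_integral_of_nonneg (.of_forall fun ω => by positivity) hX _

lemma card_sym2_le_sq (V : Type*) [Fintype V] :
    (Fintype.card (Sym2 V) : ℝ) ≤ (Fintype.card V : ℝ) ^ 2 := by
  classical
  have h := Fintype.card_le_of_surjective _ (Sym2.mk_surjective (α := V))
  rw [Fintype.card_prod, ← sq] at h
  exact_mod_cast h

lemma isSymm_edgeMatrix {V : Type*} (a : Sym2 V → ℝ) : (edgeMatrix a).IsSymm := by
  ext u w
  simp only [edgeMatrix, Matrix.transpose_apply, Matrix.of_apply, Sym2.eq_swap (a := w)]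

variable {V Ω : Type*} [Fintype V] [MeasurableSpace Ω] {P : Measure Ω} {x : Sym2 V → Ω → ℝ}

open scoped Matrix.Norms.L2Operator in
lemma norm_edgeMatrix_le_add_of_forall_abs_lt [DecidableEq V] {c b : ℝ} {ω : Ω}
    (hc : ∀ e, |x e ω| < c) (hb : ∀ e, |∫ ω, truncation (x e) c ω ∂P| ≤ b) (hb0 : 0 ≤ b) :
    ‖edgeMatrix (fun e => x e ω)‖ ≤
      ‖edgeMatrix (fun e => centeredTruncation P (x e) c ω)‖ + Fintype.card V * b := by
  have hsplit : edgeMatrix (fun e => x e ω) =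
      edgeMatrix (fun e => centeredTruncation P (x e) c ω) +
        edgeMatrix (fun e => ∫ ω, truncation (x e) c ω ∂P) := by
    ext u w
    simp [edgeMatrix, centeredTruncation, truncation_eq_self (hc s(u, w))]
  rw [hsplit]
  exact (norm_add_le _ _).trans (by gcongr; exact norm_le_card_mul hb0 fun u w => hb s(u, w))

variable [IsProbabilityMeasure P]

lemma measureReal_exists_le_abs_le {k : ℕ} (hint : ∀ e, Integrable (fun ω => |x e ω| ^ k) P)
    {M : ℝ} (hM : ∀ e, ∫ ω, |x e ω| ^ k ∂P ≤ M) (hM0 : 0 ≤ M) {c : ℝ} (hc : 0 < c) :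
    P.real {ω | ∃ e, c ≤ |x e ω|} ≤ Fintype.card V ^ 2 * (M / c ^ k) := by
  rw [Set.ofPred_exists]
  calc P.real (⋃ e, {ω | c ≤ |x e ω|}) ≤ ∑ e, P.real {ω | c ≤ |x e ω|} :=
        measureReal_iUnion_fintype_le _
    _ ≤ ∑ _e : Sym2 V, M / c ^ k := by
        gcongr with e
        exact (measureReal_le_abs_le (hint e) hc).trans (by gcongr; exact hM e)
    _ = Fintype.card (Sym2 V) * (M / c ^ k) := by simp
    _ ≤ Fintype.card V ^ 2 * (M / c ^ k) := by
        gcongr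
        exact card_sym2_le_sq V

open scoped Matrix.Norms.L2Operator

variable [DecidableEq V] {q : ℝ}

lemma IsNormalizedFamily.measureReal_le_norm_edgeMatrix_le_of_bounded
    (hx : IsNormalizedFamily P x) {K L : ℝ} (hK : ∀ e ω, |x e ω| ≤ K) (hK0 : 0 ≤ K) (hq : 0 < q)
    (hsupp : ∀ u, ({w | x s(u, w) ≠ 0}.ncard : ℝ) ≤ q ^ 2) {p : ℕ} (hp : p ≠ 0)
    (hpL : 1 + 2 * (p : ℝ) ≤ L) {s : ℝ} (hs : 0 < s) :
    P.real {ω | s ≤ ‖edgeMatrix (fun e => x e ω)‖} ≤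
      Fintype.card V * (stepFactor K L q * q / s) ^ (2 * p) := by
  have htrace_nonneg (ω : Ω) : 0 ≤ (edgeMatrix (fun e => x e ω) ^ (2 * p)).trace :=
    (pow_nonneg (norm_nonneg (edgeMatrix fun e => x e ω)) _).trans
      (norm_pow_two_mul_le_trace (isSymm_edgeMatrix _) hp)
  rw [div_pow, ← mul_div_assoc, le_div_iff₀' (by positivity)]
  calc s ^ (2 * p) * P.real {ω | s ≤ ‖edgeMatrix (fun e => x e ω)‖}
      ≤ s ^ (2 * p) *
          P.real {ω | s ^ (2 * p) ≤ (edgeMatrix (fun e => x e ω) ^ (2 * p)).trace} := by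
        refine mul_le_mul_of_nonneg_left (measureReal_mono fun ω hω => ?_) (by positivity)
        exact (pow_le_pow_left₀ hs.le hω _).trans
          (norm_pow_two_mul_le_trace (isSymm_edgeMatrix _) hp)
    _ ≤ ∫ ω, (edgeMatrix (fun e => x e ω) ^ (2 * p)).trace ∂P :=
        mul_meas_ge_le_integral_of_nonneg (.of_forall htrace_nonneg)
          (integrable_trace_edgeMatrix_pow hx.measurable hK _) _
    _ ≤ Fintype.card V * (stepFactor K L q * q) ^ (2 * p) :=
        hx.integral_trace_edgeMatrix_pow_le hK hK0 hq hsupp (by exact_mod_cast hpL)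

theorem IsNormalizedFamily.measureReal_lt_norm_edgeMatrix_le (hx : IsNormalizedFamily P x)
    (hx2 : ∀ e, MemLp (x e) 2 P) {k : ℕ} (hint : ∀ e, Integrable (fun ω => |x e ω| ^ (k + 1)) P)
    {M : ℝ} (hM : ∀ e, ∫ ω, |x e ω| ^ (k + 1) ∂P ≤ M) (hM0 : 0 ≤ M) (hq : 0 < q)
    (hsupp : ∀ u, ({w | x s(u, w) ≠ 0}.ncard : ℝ) ≤ q ^ 2) {p : ℕ} (hp : p ≠ 0) {c : ℝ}
    (hpc : 1 + 2 * (p : ℝ) ≤ c) {s : ℝ} (hs : 0 < s) :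
    P.real {ω | s + Fintype.card V * (M / c ^ k) < ‖edgeMatrix (fun e => x e ω)‖} ≤
      Fintype.card V ^ 2 * (M / c ^ (k + 1)) +
        Fintype.card V * (stepFactor (2 * c) c q * q / s) ^ (2 * p) := by
  have hc : 0 < c := by linarith [(Nat.cast_nonneg p : (0 : ℝ) ≤ p)]
  set y : Sym2 V → Ω → ℝ := fun e => BandMatrix.centeredTruncation P (x e) c
  have hbias (e : Sym2 V) : |∫ ω, truncation (x e) c ω ∂P| ≤ M / c ^ k :=
    (abs_integral_truncation_le ((hx2 e).integrable one_le_two) (hx.mean_zero e) (hint e) hc).trans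
      (by gcongr; exact hM e)
  have hsupp_y (u : V) : ({w | y s(u, w) ≠ 0}.ncard : ℝ) ≤ q ^ 2 := by
    refine le_trans ?_ (hsupp u)
    refine mod_cast Set.ncard_le_ncard fun w hw hzero => hw ?_
    simp only [y, hzero, centeredTruncation_zero]
  have hcover : {ω | s + Fintype.card V * (M / c ^ k) < ‖edgeMatrix (fun e => x e ω)‖} ⊆
      {ω | ∃ e, c ≤ |x e ω|} ∪ {ω | s ≤ ‖edgeMatrix (fun e => y e ω)‖} := by
    intro ω hω
    by_contra hnot
    simp only [Set.mem_union, Set.mem_ofPred_eq, not_or, not_exists, not_le] at hω hnot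
    linarith [norm_edgeMatrix_le_add_of_forall_abs_lt hnot.1 hbias (by positivity)]
  calc P.real {ω | s + Fintype.card V * (M / c ^ k) < ‖edgeMatrix (fun e => x e ω)‖}
      ≤ P.real {ω | ∃ e, c ≤ |x e ω|} + P.real {ω | s ≤ ‖edgeMatrix (fun e => y e ω)‖} :=
        (measureReal_mono hcover).trans (measureReal_union_le _ _)
    _ ≤ _ := add_le_add (measureReal_exists_le_abs_le hint hM hM0 hc) <|
        (hx.centeredTruncation hx2 c).measureReal_le_norm_edgeMatrix_le_of_bounded
          (fun e => abs_centeredTruncation_le (x e) hc.le) (by positivity) hq hsupp_y hp hpc hs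

end TailBound

section Asymptotics

open Asymptotics Topology

lemma tendsto_stepFactor {ι : Type*} {l : Filter ι} {c q : ι → ℝ}
    (hcq : Tendsto (fun i => c i ^ 3 / q i) l (𝓝 0)) (hq : Tendsto q l atTop) :
    Tendsto (fun i => stepFactor (2 * c i) (c i) (q i)) l (𝓝 2) := by
  have hfactor : (fun i => stepFactor (2 * c i) (c i) (q i)) =
      fun i => 2 + c i ^ 3 / q i * (q i)⁻¹ + 2 * (c i ^ 3 / q i) := by
    ext i
    rw [stepFactor]
    ring
  rw [hfactor]
  simpa using (tendsto_const_nhds.add (hcq.mul hq.inv_tendsto_atTop)).add (hcq.const_mul 2)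

lemma rpow_le_rpow_pow {a δ s : ℝ} (ha : 1 ≤ a) {k : ℕ} (hk : s ≤ δ * k) :
    a ^ s ≤ (a ^ δ) ^ k := by
  rw [← Real.rpow_mul_natCast (by positivity)]
  exact Real.rpow_le_rpow_of_exponent_le ha hk

lemma isBigO_const_div_rpow_pow {δ s : ℝ} (M : ℝ) {k : ℕ} (hk : s ≤ δ * k) :
    (fun N : ℕ => M / ((N : ℝ) ^ δ) ^ k) =O[atTop] fun N : ℕ => ((N : ℝ) ^ s)⁻¹ := by
  refine .of_bound |M| ?_
  filter_upwards [eventually_ge_atTop 1] with N hN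
  have hN1 : (1 : ℝ) ≤ N := by exact_mod_cast hN
  rw [norm_div, Real.norm_eq_abs, div_eq_mul_inv, Real.norm_of_nonneg (by positivity),
    Real.norm_of_nonneg (by positivity)]
  gcongr
  exact rpow_le_rpow_pow hN1 hk

lemma isBigO_pow_mul {f : ℕ → ℝ} {s : ℝ} (m : ℕ)
    (hf : f =O[atTop] fun N : ℕ => ((N : ℝ) ^ (s + m))⁻¹) :
    (fun N : ℕ => (N : ℝ) ^ m * f N) =O[atTop] fun N : ℕ => ((N : ℝ) ^ s)⁻¹ := by
  refine ((isBigO_refl (fun N : ℕ => (N : ℝ) ^ m) atTop).mul hf).congr' .rfl ?_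
  filter_upwards [eventually_gt_atTop 0] with N hN
  have hN' : (0 : ℝ) < N := by exact_mod_cast hN
  rw [Real.rpow_add_natCast hN'.ne', mul_inv, mul_left_comm, mul_inv_cancel₀ (by positivity),
    mul_one]

lemma isBigO_pow_two_mul_floor_rpow {θ δ : ℝ} (hθ0 : 0 < θ) (hθ1 : θ < 1) (hδ : 0 < δ) (s : ℝ) :
    (fun N : ℕ => θ ^ (2 * ⌊((N : ℝ) ^ δ - 1) / 2⌋₊)) =O[atTop] fun N : ℕ => ((N : ℝ) ^ s)⁻¹ := by
  have hdecay : Tendsto (fun N : ℕ => (N : ℝ) ^ s * θ ^ ((N : ℝ) ^ δ)) atTop (𝓝 0) := by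
    have h := (tendsto_rpow_mul_exp_neg_mul_atTop_nhds_zero (s / δ) (-Real.log θ)
      (neg_pos.2 (Real.log_neg hθ0 hθ1))).comp
        ((tendsto_rpow_atTop hδ).comp tendsto_natCast_atTop_atTop)
    refine h.congr fun N => ?_
    simp only [Function.comp_apply, neg_neg]
    rw [← Real.rpow_mul (Nat.cast_nonneg N), mul_div_cancel₀ _ hδ.ne', Real.rpow_def_of_pos hθ0]
  refine .of_bound (θ ^ (-3 : ℝ)) ?_
  filter_upwards [hdecay.eventually_le_const one_pos, eventually_gt_atTop 0] with N hN hN0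
  have hNs : 0 < (N : ℝ) ^ s := by positivity
  rw [Real.norm_of_nonneg (by positivity), Real.norm_of_nonneg (by positivity)]
  calc θ ^ (2 * ⌊((N : ℝ) ^ δ - 1) / 2⌋₊) ≤ θ ^ (-3 + (N : ℝ) ^ δ) := by
        rw [← Real.rpow_natCast]
        refine Real.rpow_le_rpow_of_exponent_ge hθ0 hθ1.le ?_
        push_cast
        linarith [Nat.lt_floor_add_one (((N : ℝ) ^ δ - 1) / 2)]
    _ = θ ^ (-3 : ℝ) * θ ^ ((N : ℝ) ^ δ) := Real.rpow_add hθ0 _ _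
    _ ≤ θ ^ (-3 : ℝ) * ((N : ℝ) ^ s)⁻¹ := by
        gcongr
        rwa [← one_div, le_div_iff₀' hNs]

section Growth

variable {β : ℕ → ℝ} {C γ : ℝ}

lemma tendsto_sqrt_atTop_of_rpow_le (hC : 0 < C) (hγ : 0 < γ)
    (hgrowth : ∀ᶠ N : ℕ in atTop, C * (N : ℝ) ^ γ ≤ β N) :
    Tendsto (fun N => √(β N)) atTop atTop :=
  Real.tendsto_sqrt_atTop.comp <| tendsto_atTop_mono' _ hgrowth <|
    ((tendsto_rpow_atTop hγ).comp tendsto_natCast_atTop_atTop).const_mul_atTop hC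

lemma tendsto_rpow_pow_three_div_sqrt (hC : 0 < C) {δ : ℝ} (hδ : 6 * δ < γ)
    (hgrowth : ∀ᶠ N : ℕ in atTop, C * (N : ℝ) ^ γ ≤ β N) :
    Tendsto (fun N : ℕ => ((N : ℝ) ^ δ) ^ 3 / √(β N)) atTop (𝓝 0) := by
  have hlim : Tendsto (fun N : ℕ => (N : ℝ) ^ (-(γ / 2 - 3 * δ)) / √C) atTop (𝓝 0) := by
    have hpos : 0 < γ / 2 - 3 * δ := by linarith
    simpa only [zero_div, Function.comp_apply] using
      ((tendsto_rpow_neg_atTop hpos).comp tendsto_natCast_atTop_atTop).div_const (√C)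
  refine squeeze_zero' (.of_forall fun N => by positivity) ?_ hlim
  filter_upwards [hgrowth, eventually_gt_atTop 0] with N hN hN0
  have hN0' : (0 : ℝ) < N := by exact_mod_cast hN0
  calc ((N : ℝ) ^ δ) ^ 3 / √(β N) ≤ ((N : ℝ) ^ δ) ^ 3 / √(C * (N : ℝ) ^ γ) := by gcongr
    _ = (N : ℝ) ^ (-(γ / 2 - 3 * δ)) / √C := by
        rw [Real.sqrt_mul hC.le, Real.sqrt_eq_rpow ((N : ℝ) ^ γ), ← Real.rpow_mul hN0'.le,
          ← Real.rpow_mul_natCast hN0'.le, mul_comm (√C), ← div_div, ← Real.rpow_sub hN0']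
        congr 2
        push_cast
        ring

end Growth

lemma ae_eventually_notMem_of_isBigO {Ω : Type*} [MeasurableSpace Ω] {P : Measure Ω}
    [IsFiniteMeasure P] {s : ℕ → Set Ω}
    (h : (fun N => P.real (s N)) =O[atTop] fun N : ℕ => ((N : ℝ) ^ (2 : ℝ))⁻¹) :
    ∀ᵐ ω ∂P, ∀ᶠ N in atTop, ω ∉ s N := by
  have hinv : Summable fun N : ℕ => ((N : ℝ) ^ (2 : ℝ))⁻¹ :=
    Real.summable_nat_rpow_inv.2 (by norm_num)
  have hsum : Summable fun N => P.real (s N) := summable_of_isBigO_nat hinv h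
  refine ae_eventually_notMem ?_
  simpa using hsum.tsum_ofReal_ne_top

lemma limsup_coe_le_of_forall_nat {u : ℕ → ℝ} {a : ℝ}
    (h : ∀ n : ℕ, ∀ᶠ N in atTop, u N ≤ a + 1 / (n + 1)) :
    limsup (fun N => (u N : EReal)) atTop ≤ a := by
  refine EReal.le_of_forall_lt_iff_le.1 fun z hz => ?_
  obtain ⟨n, hn⟩ := exists_nat_one_div_lt (sub_pos.2 (EReal.coe_lt_coe_iff.1 hz))
  refine limsup_le_of_le (h := ?_)
  filter_upwards [h n] with N hN
  exact EReal.coe_le_coe_iff.2 (by linarith)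

end Asymptotics

section SparseWigner

open Asymptotics Topology

/-- A generalized Wigner ensemble: symmetric random matrices whose entries on and above the diagonal
are independent, centered, of variance at most one, with moments bounded uniformly in `N`, and whose
`N`-th member has at most `β N` entries in each row that do not vanish identically. -/
structure IsSparseWigner {Ω : Type*} [MeasurableSpace Ω] (P : Measure Ω) (β : ℕ → ℝ)
    (X : ∀ N : ℕ, Ω → Matrix (Fin N) (Fin N) ℝ) : Prop extends IsMatrixEnsemble X where
  indep : ∀ N : ℕ,
    iIndepFun (fun (p : {p : Fin N × Fin N // p.1 ≤ p.2}) (ω : Ω) => X N ω p.1.1 p.1.2) P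
  mean_zero : ∀ (N : ℕ) (i j : Fin N), ∫ ω, X N ω i j ∂P = 0
  second_moment_le_one : ∀ (N : ℕ) (i j : Fin N), ∫ ω, X N ω i j ^ 2 ∂P ≤ 1
  integrable : ∀ (N : ℕ) (i j : Fin N) (k : ℕ), Integrable (fun ω => |X N ω i j| ^ k) P
  moments_bounded : ∀ k : ℕ, ∃ M : ℝ, ∀ (N : ℕ) (i j : Fin N), ∫ ω, |X N ω i j| ^ k ∂P ≤ M
  card_support_le : ∀ (N : ℕ) (i : Fin N), ({j | (fun ω => X N ω i j) ≠ 0}.ncard : ℝ) ≤ β N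

/-- The entries of a matrix ensemble as a family indexed by unordered pairs. -/
def edgeEntry {Ω : Type*} (X : ∀ N : ℕ, Ω → Matrix (Fin N) (Fin N) ℝ) (N : ℕ) (e : Sym2 (Fin N))
    (ω : Ω) : ℝ :=
  X N ω e.inf e.sup

variable {Ω : Type*} [MeasurableSpace Ω] {P : Measure Ω} {β : ℕ → ℝ}
  {X : ∀ N : ℕ, Ω → Matrix (Fin N) (Fin N) ℝ}

lemma IsMatrixEnsemble.edgeEntry_mk (hX : IsMatrixEnsemble X) (N : ℕ) (i j : Fin N) :
    edgeEntry X N s(i, j) = fun ω => X N ω i j := by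
  ext ω
  obtain h | h := le_total i j
  · simp [edgeEntry, h]
  · simp [edgeEntry, h, hX.symm N i j]

lemma IsMatrixEnsemble.edgeMatrix_edgeEntry (hX : IsMatrixEnsemble X) (N : ℕ) (ω : Ω) :
    edgeMatrix (fun e => edgeEntry X N e ω) = X N ω := by
  ext i j
  simp [edgeMatrix, hX.edgeEntry_mk]

namespace IsSparseWigner

lemma isNormalizedFamily_edgeEntry (hX : IsSparseWigner P β X) (N : ℕ) :
    IsNormalizedFamily P (edgeEntry X N) where
  measurable _ := hX.measurable N _ _
  indep := (hX.indep N).precomp (g := Sym2.sortEquiv (α := Fin N)) Sym2.sortEquiv.injective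
  mean_zero _ := hX.mean_zero N _ _
  second_moment_le_one _ := hX.second_moment_le_one N _ _

variable [IsProbabilityMeasure P]

lemma measureReal_lt_opNorm_le (hX : IsSparseWigner P β X) {M : ℝ} (hM0 : 0 ≤ M) {k : ℕ}
    (hM : ∀ N i j, ∫ ω, |X N ω i j| ^ (k + 1) ∂P ≤ M) {N : ℕ} (hβ : 0 < β N) {p : ℕ} (hp : p ≠ 0)
    {c : ℝ} (hpc : 1 + 2 * (p : ℝ) ≤ c) {s : ℝ} (hs : 0 < s) :
    P.real {ω | s + N * (M / c ^ k) < opNorm (X N ω)} ≤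
      N ^ 2 * (M / c ^ (k + 1)) + N * (stepFactor (2 * c) c √(β N) * √(β N) / s) ^ (2 * p) := by
  have hx2 (e : Sym2 (Fin N)) : MemLp (edgeEntry X N e) 2 P :=
    (memLp_two_iff_integrable_sq (hX.measurable N _ _).aestronglyMeasurable).2 <| by
      simpa only [sq_abs] using hX.integrable N e.inf e.sup 2
  have hsupp (i : Fin N) : ({j | edgeEntry X N s(i, j) ≠ 0}.ncard : ℝ) ≤ √(β N) ^ 2 := by
    simpa only [Real.sq_sqrt hβ.le, hX.edgeEntry_mk] using hX.card_support_le N i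
  have htail := (hX.isNormalizedFamily_edgeEntry N).measureReal_lt_norm_edgeMatrix_le hx2
    (fun _ => hX.integrable N _ _ _) (fun _ => hM N _ _) hM0 (Real.sqrt_pos.2 hβ) hsupp hp hpc hs
  simpa only [hX.edgeMatrix_edgeEntry, Fintype.card_fin, opNorm, Matrix.cstar_norm_def] using htail

lemma eventually_measureReal_lt_opNorm_le (hX : IsSparseWigner P β X) {C γ δ : ℝ} (hC : 0 < C)
    (hδ0 : 0 < δ) (hδ : 6 * δ < γ) (hgrowth : ∀ᶠ N : ℕ in atTop, C * (N : ℝ) ^ γ ≤ β N)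
    {M : ℝ} (hM0 : 0 ≤ M) {k : ℕ} (hM : ∀ N i j, ∫ ω, |X N ω i j| ^ (k + 1) ∂P ≤ M)
    {ρ τ : ℝ} (hρ : 2 < ρ) (hτ : 0 < τ) :
    ∀ᶠ N : ℕ in atTop,
      P.real {ω | τ * √(β N) + N * (M / ((N : ℝ) ^ δ) ^ k) < opNorm (X N ω)} ≤
        N ^ 2 * (M / ((N : ℝ) ^ δ) ^ (k + 1)) +
          N * (ρ / τ) ^ (2 * ⌊((N : ℝ) ^ δ - 1) / 2⌋₊) := by
  have hq := tendsto_sqrt_atTop_of_rpow_le hC (by linarith) hgrowth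
  have hstep := (tendsto_stepFactor (tendsto_rpow_pow_three_div_sqrt hC hδ hgrowth)
    hq).eventually_le_const hρ
  have hc : Tendsto (fun N : ℕ => (N : ℝ) ^ δ) atTop atTop :=
    (tendsto_rpow_atTop hδ0).comp tendsto_natCast_atTop_atTop
  filter_upwards [hstep, hc.eventually_ge_atTop 3, hq.eventually_gt_atTop 0] with N hN hc3 hqN
  have hp : ⌊((N : ℝ) ^ δ - 1) / 2⌋₊ ≠ 0 := (Nat.floor_pos.2 (by linarith)).ne'
  have hpc : 1 + 2 * (⌊((N : ℝ) ^ δ - 1) / 2⌋₊ : ℝ) ≤ (N : ℝ) ^ δ := by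
    linarith [Nat.floor_le (show 0 ≤ ((N : ℝ) ^ δ - 1) / 2 by linarith)]
  have hnonneg : 0 ≤ stepFactor (2 * (N : ℝ) ^ δ) ((N : ℝ) ^ δ) √(β N) :=
    stepFactor_nonneg (by positivity) (by positivity) hqN
  have h := hX.measureReal_lt_opNorm_le hM0 hM (Real.sqrt_pos.1 hqN) hp hpc
    (s := τ * √(β N)) (by positivity)
  rw [mul_div_mul_right _ _ hqN.ne'] at h
  exact h.trans (by gcongr)

lemma isBigO_measureReal_lt_opNorm (hX : IsSparseWigner P β X) {C γ δ : ℝ} (hC : 0 < C)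
    (hδ0 : 0 < δ) (hδ : 6 * δ < γ) (hgrowth : ∀ᶠ N : ℕ in atTop, C * (N : ℝ) ^ γ ≤ β N)
    {M : ℝ} (hM0 : 0 ≤ M) {k : ℕ} (hM : ∀ N i j, ∫ ω, |X N ω i j| ^ (k + 1) ∂P ≤ M)
    (hk : 4 ≤ δ * k) {τ : ℝ} (hτ : 2 < τ) :
    (fun N : ℕ => P.real {ω | τ * √(β N) + N * (M / ((N : ℝ) ^ δ) ^ k) < opNorm (X N ω)})
      =O[atTop] fun N : ℕ => ((N : ℝ) ^ (2 : ℝ))⁻¹ := by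
  obtain ⟨ρ, hρ2, hρτ⟩ := exists_between hτ
  have hlarge_entry := isBigO_pow_mul (s := 2) 2 <|
    isBigO_const_div_rpow_pow (s := 2 + (2 : ℕ)) (δ := δ) (k := k + 1) M (by push_cast; linarith)
  have htrace := isBigO_pow_mul (s := 2) 1 <|
    isBigO_pow_two_mul_floor_rpow (show 0 < ρ / τ by positivity)
      ((div_lt_one (by linarith)).2 hρτ) hδ0 _
  simp only [pow_one] at htrace
  refine .trans (.of_bound' ?_) (hlarge_entry.add htrace)
  filter_upwards [hX.eventually_measureReal_lt_opNorm_le hC hδ0 hδ hgrowth hM0 hM hρ2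
    (zero_lt_two.trans hτ)] with N hN
  rw [Real.norm_of_nonneg measureReal_nonneg]
  exact hN.trans (le_abs_self _)

lemma ae_eventually_opNorm_le (hX : IsSparseWigner P β X) {C γ : ℝ} (hC : 0 < C) (hγ : 0 < γ)
    (hgrowth : ∀ᶠ N : ℕ in atTop, C * (N : ℝ) ^ γ ≤ β N) {σ : ℝ} (hσ : 2 < σ) :
    ∀ᵐ ω ∂P, ∀ᶠ N in atTop, opNorm (X N ω) ≤ σ * √(β N) := by
  obtain ⟨τ, hτ2, hτσ⟩ := exists_between hσ
  obtain ⟨k, hk⟩ := exists_nat_ge (4 / (γ / 12))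
  rw [div_le_iff₀' (by positivity)] at hk
  obtain ⟨M, hM⟩ := hX.moments_bounded (k + 1)
  have hM0 : 0 ≤ M := (integral_nonneg fun ω => by positivity).trans (hM 1 0 0)
  have hbias : Tendsto (fun N : ℕ => N * (M / ((N : ℝ) ^ (γ / 12)) ^ k)) atTop (𝓝 0) := by
    have h := isBigO_pow_mul (s := 3) 1 <|
      isBigO_const_div_rpow_pow (s := 3 + (1 : ℕ)) M (hk.trans' (by norm_num))
    simp only [pow_one] at h
    exact h.trans_tendsto <| tendsto_inv_atTop_zero.comp <|
      (tendsto_rpow_atTop three_pos).comp tendsto_natCast_atTop_atTop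
  have hslack := ((tendsto_sqrt_atTop_of_rpow_le hC hγ hgrowth).const_mul_atTop
    (sub_pos.2 hτσ)).eventually_ge_atTop 1
  filter_upwards [ae_eventually_notMem_of_isBigO <| hX.isBigO_measureReal_lt_opNorm hC
    (by positivity) (by linarith) hgrowth hM0 hM hk hτ2] with ω hω
  filter_upwards [hω, hbias.eventually_le_const one_pos, hslack] with N hN hbiasN hslackN
  linarith [not_lt.1 hN]

end IsSparseWigner

lemma opNorm_smul {N : ℕ} (a : ℝ) (M : Matrix (Fin N) (Fin N) ℝ) :
    opNorm (a • M) = |a| * opNorm M := by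
  rw [opNorm, opNorm, map_smul, norm_smul, Real.norm_eq_abs]

end SparseWigner

section Band

lemma cyclicAbs_sub_comm (N : ℕ) (s t : ℤ) : cyclicAbs N (s - t) = cyclicAbs N (t - s) := by
  rw [cyclicAbs, cyclicAbs, abs_sub_comm]

lemma ncard_cyclicAbs_le (b : ℕ) {N : ℕ} (i : Fin N) :
    {j : Fin N | cyclicAbs N (((i : ℕ) : ℤ) - ((j : ℕ) : ℤ)) ≤ b}.ncard ≤ 2 * b + 1 := by
  have hcard : (Set.Icc (-(b : ℤ)) b).ncard = 2 * b + 1 := by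
    rw [← Finset.coe_Icc, Set.ncard_coe_finset, Int.card_Icc]
    omega
  -- `j` is sent to the representative of `j - i` modulo `N` in `[-b, b]`.
  let offset (j : Fin N) : ℤ :=
    if |((i : ℕ) : ℤ) - ((j : ℕ) : ℤ)| ≤ (b : ℤ) then (j : ℤ) - i
    else if (i : ℕ) < (j : ℕ) then (j : ℤ) - i - N else (j : ℤ) - i + N
  rw [← hcard]
  refine Set.ncard_le_ncard_of_injOn offset (fun j hj => ?_) (fun j _ j' _ h => ?_)
  · simp only [Set.mem_ofPred_eq, cyclicAbs] at hj
    simp only [offset, Set.mem_Icc]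
    grind
  · simp only [offset] at h
    grind

lemma ncard_abs_sub_le (b : ℕ) {N : ℕ} (i : Fin N) :
    {j : Fin N | |((i : ℕ) : ℤ) - ((j : ℕ) : ℤ)| ≤ (b : ℤ)}.ncard ≤ 2 * b + 1 := by
  refine (Set.ncard_le_ncard fun j hj => ?_).trans (ncard_cyclicAbs_le b i)
  rw [Set.mem_ofPred_eq] at hj ⊢
  exact (min_le_left _ _).trans hj

variable {Ω : Type*} [MeasurableSpace Ω] {P : Measure Ω} [IsProbabilityMeasure P]
  {X Y : ∀ N : ℕ, Ω → Matrix (Fin N) (Fin N) ℝ}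

lemma IsWignerEnsemble.isSparseWigner_of_mask (hY : IsWignerEnsemble P Y)
    (hmom : AllMomentsExist P X) {R : ∀ N, Fin N → Fin N → Prop} [∀ N i j, Decidable (R N i j)]
    (hX : ∀ N ω i j, X N ω i j = if R N i j then Y N ω i j else 0)
    (hsymm : ∀ N i j, R N i j ↔ R N j i) {β : ℕ → ℝ}
    (hcard : ∀ N i, ({j | R N i j}.ncard : ℝ) ≤ β N) : IsSparseWigner P β X where
  measurable N i j := by
    simp_rw [hX]
    exact .ite (.const _) (hY.measurable N i j) measurable_const
  symm N i j ω := by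
    rw [hX, hX, hY.symm N i j, if_congr (hsymm N i j) rfl rfl]
  indep N := by
    simp_rw [hX]
    exact (hY.indep N).comp (fun p t => if R N p.1.1 p.1.2 then t else 0)
      fun p => .ite (.const _) measurable_id measurable_const
  mean_zero N i j := by
    simp_rw [hX]
    split_ifs
    · exact hY.mean_zero N i j
    · exact integral_zero _ _
  second_moment_le_one N i j := by
    simp_rw [hX]
    split_ifs
    · exact (hY.second_moment N i j).le
    · simp
  integrable := hmom
  moments_bounded k := by
    refine ⟨max (∫ ω, |Y 1 ω 0 0| ^ k ∂P) 1, fun N i j => ?_⟩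
    simp_rw [hX]
    split_ifs
    · have hident := (hY.identDistrib N 1 i j 0 0).comp (u := fun t : ℝ => |t| ^ k)
        (measurable_norm.pow_const k)
      exact hident.integral_eq.le.trans (le_max_left _ _)
    · refine le_max_of_le_right ?_
      simpa using pow_le_one₀ (n := k) le_rfl zero_le_one
  card_support_le N i := by
    refine le_trans (mod_cast Set.ncard_le_ncard fun j hj => ?_) (hcard N i)
    by_contra hR
    exact hj (funext fun ω => (hX N ω i j).trans (if_neg hR))

variable {b : ℕ → ℕ}

lemma IsBandedWigner.isSparseWigner (hX : IsBandedWigner P b X) (hmom : AllMomentsExist P X) :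
    IsSparseWigner P (fun N => bandWidth b N) X := by
  obtain ⟨-, Y, hY, hXY⟩ := hX
  exact hY.isSparseWigner_of_mask hmom hXY (fun N i j => by rw [abs_sub_comm])
    fun N i => mod_cast ncard_abs_sub_le (b N) i

lemma IsPeriodicBandedWigner.isSparseWigner (hX : IsPeriodicBandedWigner P b X)
    (hmom : AllMomentsExist P X) : IsSparseWigner P (fun N => bandWidth b N) X := by
  obtain ⟨-, Y, hY, hXY⟩ := hX
  exact hY.isSparseWigner_of_mask hmom hXY (fun N i j => by rw [cyclicAbs_sub_comm])
    fun N i => mod_cast ncard_cyclicAbs_le (b N) i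

end Band

end BandMatrix

theorem theorem4p4_general {Ω : Type*} [MeasurableSpace Ω] {P : Measure Ω} [IsProbabilityMeasure P]
    {β : ℕ → ℝ} {X : ∀ N : ℕ, Ω → Matrix (Fin N) (Fin N) ℝ}
    (hX : BandMatrix.IsSparseWigner P β X) {C γ : ℝ} (hC : 0 < C) (hγ : 0 < γ)
    (hgrowth : ∀ᶠ N : ℕ in atTop, C * (N : ℝ) ^ γ ≤ β N) :
    ∀ᵐ ω ∂P, limsup (fun N : ℕ => ((BandMatrix.opNorm ((1 / √(β N)) • X N ω) : ℝ) : EReal))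
      atTop ≤ 2 := by
  have hlevels : ∀ᵐ ω ∂P, ∀ n : ℕ, ∀ᶠ N in atTop,
      BandMatrix.opNorm (X N ω) ≤ (2 + 1 / (n + 1)) * √(β N) :=
    ae_all_iff.2 fun n => hX.ae_eventually_opNorm_le hC hγ hgrowth <|
      lt_add_of_pos_right _ (by positivity)
  filter_upwards [hlevels] with ω hω
  refine BandMatrix.limsup_coe_le_of_forall_nat fun n => ?_
  filter_upwards [hω n, (BandMatrix.tendsto_sqrt_atTop_of_rpow_le hC hγ
    hgrowth).eventually_gt_atTop 0] with N hN hβN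
  rwa [BandMatrix.opNorm_smul, abs_of_pos (by positivity), one_div_mul_eq_div, div_le_iff₀ hβN]

/-- The `limsup` is taken in the extended reals, so the conclusion contains the boundedness of the
sequence of norms. -/
theorem theorem4p4 {Ω : Type*} [MeasurableSpace Ω] (P : Measure Ω) [IsProbabilityMeasure P]
    (b : ℕ → ℕ) (X : ∀ N : ℕ, Ω → Matrix (Fin N) (Fin N) ℝ)
    (hmom : BandMatrix.AllMomentsExist P X)
    (C γ : ℝ) (hC : 0 < C) (hγ : 0 < γ)
    (hgrowth : ∀ N : ℕ, 1 ≤ N → C * (N : ℝ) ^ γ ≤ (BandMatrix.bandWidth b N : ℝ)) :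
    (BandMatrix.IsBandedWigner P b X →
      ∀ᵐ ω ∂P, limsup (fun N : ℕ =>
        ((BandMatrix.opNorm ((1 / √(BandMatrix.bandWidth b N : ℝ)) • X N ω) : ℝ) : EReal))
          atTop ≤ 2) ∧
    (BandMatrix.IsPeriodicBandedWigner P b X →
      ∀ᵐ ω ∂P, limsup (fun N : ℕ =>
        ((BandMatrix.opNorm ((1 / √(BandMatrix.bandWidth b N : ℝ)) • X N ω) : ℝ) : EReal))
          atTop ≤ 2) := by
  have hgrowth' : ∀ᶠ N : ℕ in atTop, C * (N : ℝ) ^ γ ≤ (BandMatrix.bandWidth b N : ℝ) :=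
    eventually_atTop.2 ⟨1, hgrowth⟩
  exact ⟨fun hX => theorem4p4_general (hX.isSparseWigner hmom) hC hγ hgrowth',
    fun hX => theorem4p4_general (hX.isSparseWigner hmom) hC hγ hgrowth'⟩
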